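/- For positive integers $p,m,q$ let $S(p,m,q)=\{x\in\mathbb Z_{\ge 0} : (px \bmod m)\le qx\}$. Let $a,k$ be positive integers with $2\le k\le a$, put $b=a+k-1$ and $\lambda=\left\lfloor\frac{a-2}{k-1}\right\rfloor$, and let $S(AP(a,1;k))=\langle a,a+1,\ldots,a+k-1\rangle$ be the submonoid of $\mathbb Z_{\ge 0}$ generated by $a,a+1,\ldots,a+k-1$. Let $p,q,m$ be positive integers with $q<p<m$. Then \[ S(p,m,q)=S(AP(a,1;k)) \] if and only if at least one of the following holds: (1) $\displaystyle \frac{m}{a}\le p<\frac{m(\lambda+1)}{(\lambda+1)a-1}$ and $\displaystyle p-\frac{m}{b}\le q<p-\frac{m\lambda}{\lambda b+1}$; (2) $\displaystyle m-\frac{m}{b}\le p<m-\frac{m\lambda}{\lambda b+1}$ and $\displaystyle p-m+\frac{m}{a}\le q<p-m+\frac{m(\lambda+1)}{(\lambda+1)a-1}$; (3) $k=a$, $\displaystyle \frac{2m}{b}\le p<\frac{m}{a-1}$ and $\displaystyle p-\frac{m}{b-1}\le q<p$; (4) $k=a$, $\displaystyle m-\frac{m}{b-1}\le p<m$ and $\displaystyle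 p-m+\frac{2m}{b}\le q<p-m+\frac{m}{a-1}$. -/

import Mathlib

/-- The solution set `S(a, b, c) = {x ∈ ℤ_{≥0} : ax mod b ≤ cx}` of a proportionally modular
Diophantine inequality. -/
def propModular (a b c : ℕ) : Set ℕ := {x : ℕ | (a * x) % b ≤ c * x}

/-- The submonoid `⟨a, a + d, …, a + (k - 1)d⟩` of `ℤ_{≥0}`. -/
def apSemigroup (a d k : ℕ) : AddSubmonoid ℕ :=
  AddSubmonoid.closure {n : ℕ | ∃ i : ℕ, i < k ∧ n = a + i * d}

/-! Put r = p − q. Then x lies in S(p,m,q) exactly when some fraction n/x lies in [r/m, p/m]. The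
reflection t ↦ 1 − t keeps denominators, so the cases come in pairs, (1) with (2) and (3) with (4).

On the other side, x lies in the semigroup iff na ≤ x ≤ nb for some n. The gaps are therefore the
blocks jb < x < (j+1)a, and λ is the last j whose block is nonempty.

Sufficiency: in (1) the numerators of all generators can be taken to be 1, and avoiding both ends of
the last gap already avoids every earlier one. In (3) the semigroup is {0} ∪ [a, ∞).

Necessity: since a is the least positive element and a + 1 also belongs, their numerators are 1 up
to reflection (`unit_numerators_of_least`). Climbing through the generators, the numerator 1 keeps
working up to b, unless k = a and it must become 2 at b = 2a − 1 (`cases_of_unit_numerators`). -/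

/-- The positions `x` for which `[r x / m, p x / m]` contains an integer. -/
def intervalSet (r p m : ℤ) : Set ℕ := {x : ℕ | ∃ n : ℤ, r * x ≤ n * m ∧ n * m ≤ p * x}

/-! ### Fractions in an interval, and membership in the semigroup -/

theorem propModular_eq_intervalSet {p m q : ℕ} (hm : 0 < m) :
    propModular p m q = intervalSet ((p : ℤ) - q) p m := by
  ext x
  simp only [propModular, intervalSet, Set.mem_ofPred_eq]
  have hm' : (0 : ℤ) < m := by exact_mod_cast hm
  constructor
  · intro h
    refine ⟨((p * x / m : ℕ) : ℤ), ?_, ?_⟩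
    · have h1 : ((m * (p * x / m) + (p * x) % m : ℕ) : ℤ) = (p * x : ℕ) := by
        rw [Nat.div_add_mod]
      have h2 : (((p * x) % m : ℕ) : ℤ) ≤ ((q * x : ℕ) : ℤ) := by exact_mod_cast h
      rw [Nat.cast_add, Nat.cast_mul, Nat.cast_mul] at h1
      rw [Nat.cast_mul] at h2
      linarith
    · exact_mod_cast Nat.div_mul_le_self (p * x) m
  · rintro ⟨n, h1, h2⟩
    have h3 : ((p : ℤ) * x - n * m) % m = (p * x) % m := by
      rw [Int.sub_mul_emod_self_right]
    have h4 : ((p : ℤ) * x - n * m) % m ≤ p * x - n * m := by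
      have h6 := mul_nonneg hm'.le
        (Int.ediv_nonneg (by linarith : 0 ≤ (p : ℤ) * x - n * m) hm'.le)
      have h7 := Int.mul_ediv_add_emod ((p : ℤ) * x - n * m) m
      linarith
    have h5 : ((p : ℤ) * x) % m ≤ q * x := by rw [← h3]; linarith
    exact_mod_cast h5

/-- The fraction n/x is replaced by (x − n)/x. -/
theorem intervalSet_symm (r p m : ℤ) : intervalSet (m - p) (m - r) m = intervalSet r p m := by
  ext x
  constructor
  · rintro ⟨n, h1, h2⟩
    exact ⟨x - n, by linarith, by linarith⟩
  · rintro ⟨n, h1, h2⟩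
    exact ⟨x - n, by linarith, by linarith⟩

theorem mem_apSemigroup_one_iff {a k : ℕ} (hk : 0 < k) (x : ℕ) :
    x ∈ apSemigroup a 1 k ↔ ∃ n : ℕ, n * a ≤ x ∧ x ≤ n * (a + k - 1) := by
  obtain ⟨k, rfl⟩ : ∃ j, k = j + 1 := ⟨k - 1, by omega⟩
  have hb : a + (k + 1) - 1 = a + k := by omega
  rw [hb]
  constructor
  · intro h
    induction h using AddSubmonoid.closure_induction with
    | mem y hy =>
      obtain ⟨i, hi, rfl⟩ := hy
      exact ⟨1, by omega, by omega⟩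
    | zero => exact ⟨0, by simp, by simp⟩
    | add y z _ _ hy hz =>
      obtain ⟨n, h1, h2⟩ := hy
      obtain ⟨n', h3, h4⟩ := hz
      exact ⟨n + n', by rw [add_mul]; omega, by rw [add_mul]; omega⟩
  · rintro ⟨n, h1, h2⟩
    induction n generalizing x with
    | zero =>
      obtain rfl : x = 0 := by omega
      exact zero_mem _
    | succ n ih =>
      rw [add_mul, one_mul] at h1 h2
      have hle : n * a ≤ n * (a + k) := Nat.mul_le_mul_left _ (by omega)
      -- Greedy choice: peel off the largest generator that leaves a remainder of at least `n * a`.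
      obtain ⟨i, hi, h3, h4⟩ : ∃ i, i < k + 1 ∧ n * a + (a + i) ≤ x ∧
          x ≤ n * (a + k) + (a + i) := by
        by_cases h : n * a + a + k ≤ x
        · exact ⟨k, by omega, by omega, by omega⟩
        · exact ⟨x - n * a - a, by omega, by omega, by omega⟩
      have hx : x = (x - (a + i)) + (a + i) := by omega
      rw [hx]
      exact add_mem (ih _ (by omega) (by omega))
        (AddSubmonoid.subset_closure ⟨i, hi, by rw [mul_one]⟩)

theorem apSemigroup_one_le_intervalSet_of_generators {a k : ℕ} {r p m : ℤ}
    (h : ∀ g : ℕ, a ≤ g → g < a + k → g ∈ intervalSet r p m) {x : ℕ}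
    (hx : x ∈ apSemigroup a 1 k) : x ∈ intervalSet r p m := by
  induction hx using AddSubmonoid.closure_induction with
  | mem y hy =>
    obtain ⟨i, hi, rfl⟩ := hy
    exact h _ (by omega) (by omega)
  | zero => exact ⟨0, by simp, by simp⟩
  | add y z _ _ hy hz =>
    obtain ⟨n, h1, h2⟩ := hy
    obtain ⟨n', h3, h4⟩ := hz
    exact ⟨n + n', by push_cast; linarith, by push_cast; linarith⟩

/-! ### Sufficiency of the cases -/

/-- The interval `[r / m, p / m]` contains `1 / a` and `1 / b`, and is small enough to avoid
every gap of the semigroup. -/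
def UnitFractionCase (a b l r p m : ℤ) : Prop :=
  m ≤ p * a ∧ p * ((l + 1) * a - 1) < m * (l + 1) ∧ r * b ≤ m ∧ m * l < r * (l * b + 1)

/-- The interval `[r / m, p / m]` contains `1 / a`, `1 / (b - 1)` and `2 / b`, and lies below
`1 / (a - 1)`. -/
def HalfLineCase (a b r p m : ℤ) : Prop :=
  2 * m ≤ p * b ∧ p * (a - 1) < m ∧ r * (b - 1) ≤ m

theorem eq_apSemigroup_of_unitFractionCase {a k l : ℕ} (hk : 2 ≤ k) (hka : k ≤ a)
    (hl : a - 2 < (l + 1) * (k - 1)) {r p m : ℤ} (hr : 0 < r) (hrp : r < p)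
    (h : UnitFractionCase a (a + k - 1 : ℕ) l r p m) :
    intervalSet r p m = (apSemigroup a 1 k : Set ℕ) := by
  have hm : 0 < m := lt_of_lt_of_le (mul_pos hr (by omega)) h.2.2.1
  obtain ⟨b, hb⟩ : ∃ b, b = a + k - 1 := ⟨_, rfl⟩
  rw [← hb] at h
  obtain ⟨h1, h2, h3, h4⟩ := h
  ext x
  rw [SetLike.mem_coe, mem_apSemigroup_one_iff (by omega), ← hb]
  constructor
  · rintro ⟨n, hn1, hn2⟩
    have hn0 : 0 ≤ n := by
      by_contra hneg
      have : n * m < 0 := mul_neg_of_neg_of_pos (by omega) hm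
      have : 0 ≤ r * (x : ℤ) := by positivity
      linarith
    lift n to ℕ using hn0
    by_contra hgap
    -- locate the gap containing `x`
    have hb0 : 0 < b := by omega
    obtain ⟨j, hj1, hj2⟩ : ∃ j : ℕ, j * b < x ∧ x ≤ (j + 1) * b := by
      refine ⟨(x - 1) / b, ?_, ?_⟩
      · have hx0 : x ≠ 0 := by
          rintro rfl
          exact hgap ⟨0, by simp, by simp⟩
        have := Nat.div_mul_le_self (x - 1) b
        omega
      · have := Nat.lt_mul_div_succ (x - 1) hb0
        rw [mul_comm] at this
        omega
    have hj3 : x < (j + 1) * a := by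
      by_contra hcon
      exact hgap ⟨j + 1, by omega, hj2⟩
    have hjl : j ≤ l := by
      by_contra hcon
      have e1 : (l + 1) * (k - 1) ≤ j * (k - 1) := Nat.mul_le_mul_right _ (by omega)
      have e2 : j * b = j * a + j * (k - 1) := by
        rw [← mul_add]; congr 1; omega
      rw [add_mul] at hj3
      omega
    have hj1' : (j : ℤ) * b + 1 ≤ x := by exact_mod_cast hj1
    have hj3' : (x : ℤ) ≤ (j + 1) * a - 1 := by
      have : (x : ℤ) < (j + 1) * a := by exact_mod_cast hj3
      linarith
    have hjl' : (0 : ℤ) ≤ l - j := by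
      have : (j : ℤ) ≤ l := by exact_mod_cast hjl
      linarith
    have hp : 0 < p := hr.trans hrp
    have hnj : (n : ℤ) < j + 1 := by
      -- `p * x < m * (j + 1)`
      have e1 : p * (x : ℤ) ≤ p * ((j + 1) * a - 1) := mul_le_mul_of_nonneg_left hj3' hp.le
      -- Subtracting l − j copies of m ≤ pa moves the strict bound from the last gap l down to gap
      -- j; the lower bound below is handled in the same way with rb ≤ m.
      have e2 : 0 ≤ (l - j : ℤ) * (p * a - m) := mul_nonneg hjl' (by linarith)
      have e3 : p * (((j : ℤ) + 1) * a - 1) < m * (j + 1) := by linarith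
      have e4 : (n : ℤ) * m < (j + 1) * m := by linarith
      exact lt_of_mul_lt_mul_right e4 hm.le
    have hnj' : (j : ℤ) < n := by
      have e1 : r * ((j : ℤ) * b + 1) ≤ r * x := mul_le_mul_of_nonneg_left hj1' hr.le
      have e2 : 0 ≤ (l - j : ℤ) * (m - r * b) := mul_nonneg hjl' (by linarith)
      have e4 : (j : ℤ) * m < n * m := by linarith
      exact lt_of_mul_lt_mul_right e4 hm.le
    omega
  · rintro ⟨n, hn1, hn2⟩
    have hn1' : (n : ℤ) * a ≤ x := by exact_mod_cast hn1
    have hn2' : (x : ℤ) ≤ n * b := by exact_mod_cast hn2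
    refine ⟨n, ?_, ?_⟩
    · have e1 := mul_le_mul_of_nonneg_left hn2' hr.le
      have e2 : (n : ℤ) * (r * b) ≤ n * m := mul_le_mul_of_nonneg_left h3 (by positivity)
      linarith
    · have e1 := mul_le_mul_of_nonneg_left hn1' (hr.trans hrp).le
      have e2 : (n : ℤ) * m ≤ n * (p * a) := mul_le_mul_of_nonneg_left h1 (by positivity)
      linarith

/-- The bound p(a − 1) < m excludes positive denominators below a. Generators up to 2a − 2 get
numerator 1, and 2a − 1 gets numerator 2. -/
theorem eq_apSemigroup_of_halfLineCase {a : ℕ} (ha : 2 ≤ a) {r p m : ℤ} (hr : 0 < r)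
    (hrp : r < p) (h : HalfLineCase a (a + a - 1 : ℕ) r p m) :
    intervalSet r p m = (apSemigroup a 1 a : Set ℕ) := by
  have hb : ((a + a - 1 : ℕ) : ℤ) = 2 * a - 1 := by omega
  rw [HalfLineCase, hb] at h
  obtain ⟨h1, h2, h3⟩ := h
  have ha' : (2 : ℤ) ≤ a := by exact_mod_cast ha
  have hp : 0 < p := hr.trans hrp
  have hm : 0 < m := lt_of_le_of_lt (mul_nonneg hp.le (by linarith)) h2
  ext x
  rw [SetLike.mem_coe]
  constructor
  · rintro ⟨n, hn1, hn2⟩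
    rcases Nat.eq_zero_or_pos x with rfl | hx
    · exact zero_mem _
    have hx' : (0 : ℤ) < x := by exact_mod_cast hx
    have hn : 0 < n := by
      have : 0 < r * (x : ℤ) := by positivity
      exact pos_of_mul_pos_left (by linarith) hm.le
    have hax : a ≤ x := by
      by_contra hcon
      have e1 : p * (x : ℤ) ≤ p * (a - 1) := mul_le_mul_of_nonneg_left (by omega) hp.le
      have e2 : 1 * m ≤ n * m := mul_le_mul_of_nonneg_right (by omega) hm.le
      linarith
    rw [mem_apSemigroup_one_iff (by omega)]
    have ha0 : 0 < a := by omega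
    refine ⟨x / a, Nat.div_mul_le_self x a, ?_⟩
    have e1 := Nat.div_add_mod x a
    have e2 := Nat.mod_lt x ha0
    have e3 : 1 ≤ x / a := Nat.div_pos hax ha0
    have e4 : a + a - 1 = a + (a - 1) := by omega
    have e5 : 1 * (a - 1) ≤ x / a * (a - 1) := Nat.mul_le_mul_right _ e3
    rw [e4, mul_add, mul_comm (x / a) a]
    omega
  · refine apSemigroup_one_le_intervalSet_of_generators fun g hg1 hg2 => ?_
    have hg1' : (a : ℤ) ≤ g := by exact_mod_cast hg1
    rcases lt_or_ge (g + 1) (a + a) with hlt | hge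
    · have e1 : r * (g : ℤ) ≤ r * (2 * a - 1 - 1) := mul_le_mul_of_nonneg_left (by omega) hr.le
      have e2 : p * (a : ℤ) ≤ p * g := mul_le_mul_of_nonneg_left hg1' hp.le
      exact ⟨1, by linarith, by linarith⟩
    · obtain rfl : g = a + a - 1 := by omega
      have e1 : r * (1 : ℤ) ≤ r * (2 * a - 1 - 1) := mul_le_mul_of_nonneg_left (by omega) hr.le
      exact ⟨2, by rw [hb]; linarith, by rw [hb]; linarith⟩

/-! ### Necessity of the cases -/

/-- If `c / (a + 1)` and `c / a` lie in an interval with `2 ≤ c < a`, then so does a fraction of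
smaller denominator. -/
theorem exists_lt_mem_intervalSet {a c : ℕ} {r p m : ℤ} (hr : 0 ≤ r) (hp : 0 ≤ p)
    (hc : 2 ≤ c) (hca : c ≤ a) (h1 : r * (a + 1) ≤ c * m) (h2 : c * m ≤ p * a) :
    ∃ y, 0 < y ∧ y < a ∧ y ∈ intervalSet r p m := by
  have hc0 : 0 < c := by omega
  have e1 := Nat.div_add_mod a c
  have e2 := Nat.mod_lt a hc0
  have e3 : 1 ≤ a / c := Nat.div_pos hca hc0
  have e4 : a / c < a := Nat.div_lt_self (by omega) (by omega)
  have e1' : (c : ℤ) * (a / c : ℕ) + (a % c : ℕ) = a := by exact_mod_cast e1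
  have e2' : ((a % c : ℕ) : ℤ) + 1 ≤ c := by exact_mod_cast e2
  have hc' : (2 : ℤ) ≤ c := by exact_mod_cast hc
  -- The denominator is (c − 1)a/c rounded up, which places (c − 1)/(a − ⌊a/c⌋) between c/(a + 1)
  -- and c/a.
  refine ⟨a - a / c, by omega, by omega, c - 1, ?_, ?_⟩
  · rw [Nat.cast_sub e4.le]
    have f1 : (c : ℤ) * ((a : ℤ) - (a / c : ℕ)) ≤ (c - 1) * (a + 1) := by linarith
    have f2 := mul_le_mul_of_nonneg_left f1 hr
    have f3 : ((c : ℤ) - 1) * (r * (a + 1)) ≤ (c - 1) * (c * m) :=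
      mul_le_mul_of_nonneg_left h1 (by linarith)
    have f4 : (c : ℤ) * (r * ((a : ℤ) - (a / c : ℕ))) ≤ c * ((c - 1) * m) := by linarith
    exact le_of_mul_le_mul_left f4 (by linarith)
  · rw [Nat.cast_sub e4.le]
    have f1 : ((c : ℤ) - 1) * a ≤ c * ((a : ℤ) - (a / c : ℕ)) := by
      have : (0 : ℤ) ≤ (a % c : ℕ) := by positivity
      linarith
    have f2 := mul_le_mul_of_nonneg_left f1 hp
    have f3 : ((c : ℤ) - 1) * (c * m) ≤ (c - 1) * (p * a) :=
      mul_le_mul_of_nonneg_left h2 (by linarith)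
    have f4 : (c : ℤ) * ((c - 1) * m) ≤ c * (p * ((a : ℤ) - (a / c : ℕ))) := by linarith
    exact le_of_mul_le_mul_left f4 (by linarith)

/-- If `a` is the least positive element and `a + 1` is an element too, then the numerators of
the corresponding fractions are both `1`, possibly after reflection. -/
theorem unit_numerators_of_least {a : ℕ} (ha : 2 ≤ a) {r p m : ℤ} (hr : 0 < r) (hrp : r < p)
    (hpm : p < m) (hmin : ∀ y, 0 < y → y < a → y ∉ intervalSet r p m)
    (h0 : a ∈ intervalSet r p m) (h1 : a + 1 ∈ intervalSet r p m) :
    (m ≤ p * a ∧ r * (a + 1) ≤ m) ∨ (m ≤ (m - r) * a ∧ (m - p) * (a + 1) ≤ m) := by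
  obtain ⟨n, hn1, hn2⟩ := h0
  obtain ⟨n', hn1', hn2'⟩ := h1
  rw [Nat.cast_add, Nat.cast_one] at hn1' hn2'
  have hm : 0 < m := by linarith
  have hp : 0 < p := by linarith
  have ha' : (2 : ℤ) ≤ a := by exact_mod_cast ha
  have hnpos : 0 < n := by
    have : 0 < r * (a : ℤ) := mul_pos hr (by linarith)
    exact pos_of_mul_pos_left (by linarith) hm.le
  have hna : n < a := by
    have e1 : p * (a : ℤ) < m * a := mul_lt_mul_of_pos_right hpm (by linarith)
    exact lt_of_mul_lt_mul_right (by linarith : n * m < a * m) hm.le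
  have hpred : ∀ j : ℤ, ¬ (r * ((a : ℤ) - 1) ≤ j * m ∧ j * m ≤ p * (a - 1)) := by
    intro j hj
    refine hmin (a - 1) (by omega) (by omega) ⟨j, ?_⟩
    rw [Nat.cast_sub (by omega), Nat.cast_one]
    exact hj
  have hlow : n ≤ n' := by
    by_contra hcon
    -- `(n - 1) / a` would lie above `n' / (a + 1)`
    apply hpred (n - 1)
    have f1 : n' * m ≤ (n - 1) * m := mul_le_mul_of_nonneg_right (by omega) hm.le
    constructor <;> linarith
  -- Otherwise n/(a − 1) would lie in the interval, because p < m.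
  have hupp : n' ≤ n + 1 := by
    by_contra hcon
    apply hpred n
    have f1 : (n + 2) * m ≤ n' * m := mul_le_mul_of_nonneg_right (by omega) hm.le
    constructor <;> linarith
  obtain rfl | rfl : n' = n ∨ n' = n + 1 := by omega
  · left
    lift n' to ℕ using hnpos.le
    have hn'1 : n' = 1 := by
      by_contra hne
      obtain ⟨y, hy0, hy1, hy2⟩ := exists_lt_mem_intervalSet hr.le hp.le
        (by omega : 2 ≤ n') (by omega : n' ≤ a) hn1' hn2
      exact hmin y hy0 hy1 hy2
    subst hn'1
    constructor <;> push_cast at * <;> linarith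
  · right
    -- After reflection both fractions have the same numerator, a − n = (a + 1) − (n + 1).
    obtain ⟨c, hc⟩ : ∃ c : ℕ, (c : ℤ) = a - n := ⟨(a - n).toNat, Int.toNat_of_nonneg (by linarith)⟩
    obtain rfl : n = a - c := by omega
    have g1 : (m - p) * ((a : ℤ) + 1) ≤ c * m := by linarith
    have g2 : (c : ℤ) * m ≤ (m - r) * a := by linarith
    have hc1 : c = 1 := by
      by_contra hne
      obtain ⟨y, hy0, hy1, hy2⟩ := exists_lt_mem_intervalSet (by linarith) (by linarith)
        (by omega : 2 ≤ c) (by omega : c ≤ a) g1 g2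
      rw [intervalSet_symm] at hy2
      exact hmin y hy0 hy1 hy2
    subst hc1
    constructor <;> push_cast at * <;> linarith

/-- An induction over the generators decides whether 1/b lies in the interval. If it does, the two
strict bounds hold because (l + 1)a − 1 and lb + 1, the ends of the last gap, are not elements. -/
theorem cases_of_unit_numerators {a k l : ℕ} (hk : 2 ≤ k) (hka : k ≤ a)
    (hl : l * (k - 1) ≤ a - 2) {r p m : ℤ} (hr : 0 < r) (hrp : r < p) (hpm : p < m)
    (hS : intervalSet r p m = (apSemigroup a 1 k : Set ℕ))
    (h1 : m ≤ p * a) (h2 : r * (a + 1) ≤ m) :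
    UnitFractionCase a (a + k - 1 : ℕ) l r p m ∨
      k = a ∧ HalfLineCase a (a + k - 1 : ℕ) r p m := by
  have hmem : ∀ x, x ∈ intervalSet r p m ↔ ∃ n : ℕ, n * a ≤ x ∧ x ≤ n * (a + k - 1) := by
    intro x
    rw [hS, SetLike.mem_coe, mem_apSemigroup_one_iff (by omega)]
  have hm : 0 < m := by linarith
  have hp : 0 < p := by linarith
  have ha' : (2 : ℤ) ≤ a := by omega
  have hgap : ∀ {x j : ℕ}, j * (a + k - 1) < x → x < (j + 1) * a → x ∉ intervalSet r p m := by
    intro x j hj1 hj2 hx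
    obtain ⟨n, hn1, hn2⟩ := (hmem x).1 hx
    have f1 : n < j + 1 := lt_of_mul_lt_mul_right (hn1.trans_lt hj2) (Nat.zero_le _)
    have f2 : j < n := lt_of_mul_lt_mul_right (hj1.trans_le hn2) (Nat.zero_le _)
    omega
  have hpa : p * ((a : ℤ) - 1) < m := by
    by_contra hcon
    refine hgap (x := a - 1) (j := 0) (by omega) (by omega) ⟨1, ?_, ?_⟩ <;>
      rw [Nat.cast_sub (by omega), Nat.cast_one] <;> linarith
  have hstep : ∀ g : ℕ, a + 1 ≤ g → g ≤ a + k - 1 →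
      r * g ≤ m ∨ (k = a ∧ g = a + k - 1 ∧ 2 * m ≤ p * g ∧ r * ((g : ℤ) - 1) ≤ m) := by
    intro g hg
    induction g, hg using Nat.le_induction with
    | base => intro _; left; push_cast; exact h2
    | succ g hg ih =>
      intro hgb
      have hrg : r * (g : ℤ) ≤ m := by
        rcases ih (by omega) with h | h
        · exact h
        · omega
      obtain ⟨n, hn1, hn2⟩ := (hmem (g + 1)).2 ⟨1, by omega, by omega⟩
      rcases le_or_gt n 1 with hn | hn
      · left
        have : n * m ≤ 1 * m := mul_le_mul_of_nonneg_right hn hm.le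
        linarith
      · right
        have f1 : 2 * m ≤ n * m := mul_le_mul_of_nonneg_right (by omega) hm.le
        -- A numerator of at least 2 forces g + 1 > 2(a − 1), while g + 1 ≤ a + k − 1 ≤ 2a − 1;
        -- hence k = a and g + 1 is the last generator.
        have f2 : p * (2 * ((a : ℤ) - 1)) < p * (g + 1 : ℕ) := by linarith
        have f3 := lt_of_mul_lt_mul_left f2 hp.le
        refine ⟨by omega, by omega, by linarith, ?_⟩
        push_cast
        linarith
  rcases hstep (a + k - 1) (by omega) le_rfl with hb | ⟨hka', -, hb1, hb2⟩
  · left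
    have hla : (l + 1) * (k - 1) ≤ a - 2 + (k - 1) := by rw [add_mul]; omega
    -- The last gap is nonempty: lb + 1 ≤ (l + 1)a − 1.
    have hlb : l * (a + k - 1) + 2 ≤ (l + 1) * a := by
      have : a + k - 1 = a + (k - 1) := by omega
      rw [this, mul_add, add_mul]
      omega
    have hra : r * (a : ℤ) ≤ m := by linarith
    have hpb : m ≤ p * (a + k - 1 : ℕ) :=
      h1.trans (mul_le_mul_of_nonneg_left (by omega) hp.le)
    have hl0 : (0 : ℤ) ≤ l := by positivity
    refine ⟨h1, ?_, hb, ?_⟩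
    · by_contra hcon
      have hx : (((l + 1) * a - 1 : ℕ) : ℤ) = (l + 1) * a - 1 := by
        rw [Nat.cast_sub (by omega)]; push_cast; rfl
      refine hgap (x := (l + 1) * a - 1) (j := l) (by omega) (by omega) ⟨l + 1, ?_, ?_⟩
      · rw [hx]
        have := mul_le_mul_of_nonneg_left hra (by linarith : (0 : ℤ) ≤ l + 1)
        linarith
      · rw [hx]; linarith
    · by_contra hcon
      refine hgap (x := l * (a + k - 1) + 1) (j := l) (by omega) (by omega) ⟨l, ?_, ?_⟩
      · rw [Nat.cast_add, Nat.cast_mul, Nat.cast_one]; linarith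
      · rw [Nat.cast_add, Nat.cast_mul, Nat.cast_one]
        have := mul_le_mul_of_nonneg_left hpb hl0
        linarith
  · exact Or.inr ⟨hka', hb1, hpa, hb2⟩

/-! ### The equivalence over the integers, and its rational form -/

theorem intervalSet_eq_apSemigroup_iff {a k l : ℕ} (hk : 2 ≤ k) (hka : k ≤ a)
    (hl : l * (k - 1) ≤ a - 2) (hl' : a - 2 < (l + 1) * (k - 1)) {r p m : ℤ} (hr : 0 < r)
    (hrp : r < p) (hpm : p < m) :
    intervalSet r p m = (apSemigroup a 1 k : Set ℕ) ↔
      UnitFractionCase a (a + k - 1 : ℕ) l r p m ∨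
        UnitFractionCase a (a + k - 1 : ℕ) l (m - p) (m - r) m ∨
        k = a ∧ (HalfLineCase a (a + k - 1 : ℕ) r p m ∨
          HalfLineCase a (a + k - 1 : ℕ) (m - p) (m - r) m) := by
  constructor
  · intro hS
    have hmem : ∀ x, x ∈ intervalSet r p m ↔ ∃ n : ℕ, n * a ≤ x ∧ x ≤ n * (a + k - 1) := by
      intro x
      rw [hS, SetLike.mem_coe, mem_apSemigroup_one_iff (by omega)]
    have hmin : ∀ y, 0 < y → y < a → y ∉ intervalSet r p m := by
      intro y hy0 hya hy
      obtain ⟨n, hn1, hn2⟩ := (hmem y).1 hy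
      rcases Nat.eq_zero_or_pos n with rfl | hn
      · omega
      · have := Nat.mul_le_mul_right a hn
        omega
    rcases unit_numerators_of_least (hk.trans hka) hr hrp hpm hmin
      ((hmem a).2 ⟨1, by omega, by omega⟩) ((hmem (a + 1)).2 ⟨1, by omega, by omega⟩) with
      ⟨h1, h2⟩ | ⟨h1, h2⟩
    · have := cases_of_unit_numerators hk hka hl hr hrp hpm hS h1 h2
      tauto
    · have := cases_of_unit_numerators hk hka hl (by linarith) (by linarith) (by linarith)
        ((intervalSet_symm r p m).trans hS) h1 h2
      tauto
  · rintro (h | h | ⟨rfl, h | h⟩)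
    · exact eq_apSemigroup_of_unitFractionCase hk hka hl' hr hrp h
    · rw [← intervalSet_symm]
      exact eq_apSemigroup_of_unitFractionCase hk hka hl' (by linarith) (by linarith) h
    · exact eq_apSemigroup_of_halfLineCase hk hr hrp h
    · rw [← intervalSet_symm]
      exact eq_apSemigroup_of_halfLineCase hk (by linarith) (by linarith) h

theorem unitFractionCase_iff_rat {a b l r p m : ℤ} (ha : 2 ≤ a) (hb : 0 < b) (hl : 0 ≤ l) :
    UnitFractionCase a b l r p m ↔
      (m : ℚ) / a ≤ p ∧ (p : ℚ) < m * (l + 1) / ((l + 1) * a - 1) ∧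
        (r : ℚ) ≤ m / b ∧ (m : ℚ) * l / (l * b + 1) < r := by
  have ha' : (2 : ℚ) ≤ a := by exact_mod_cast ha
  have hb' : (0 : ℚ) < b := by exact_mod_cast hb
  have hl' : (0 : ℚ) ≤ l := by exact_mod_cast hl
  rw [div_le_iff₀ (by linarith), lt_div_iff₀ (by nlinarith), le_div_iff₀ hb',
    div_lt_iff₀ (by positivity), UnitFractionCase]
  norm_cast

theorem halfLineCase_iff_rat {a b r p m : ℤ} (ha : 2 ≤ a) (hb : 1 < b) :
    HalfLineCase a b r p m ↔
      2 * (m : ℚ) / b ≤ p ∧ (p : ℚ) < m / (a - 1) ∧ (r : ℚ) ≤ m / (b - 1) := by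
  have ha' : (2 : ℚ) ≤ a := by exact_mod_cast ha
  have hb' : (1 : ℚ) < b := by exact_mod_cast hb
  rw [div_le_iff₀ (by linarith), lt_div_iff₀ (by linarith), le_div_iff₀ (by linarith),
    HalfLineCase]
  norm_cast

theorem floor_div_spec {a k : ℕ} (hk : 2 ≤ k) (hka : k ≤ a) {l : ℕ}
    (hl : l = ⌊((a : ℚ) - 2) / ((k : ℚ) - 1)⌋₊) :
    l * (k - 1) ≤ a - 2 ∧ a - 2 < (l + 1) * (k - 1) := by
  have h : l = (a - 2) / (k - 1) := by
    rw [hl, ← Nat.floor_div_eq_div (K := ℚ), Nat.cast_sub (by omega), Nat.cast_sub (by omega)]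
    norm_num
  rw [h]
  exact ⟨Nat.div_mul_le_self _ _, mul_comm (k - 1) _ ▸ Nat.lt_mul_div_succ _ (by omega)⟩

theorem mainTheorem7 (a k : ℕ) (hk : 2 ≤ k) (hka : k ≤ a) (b l : ℕ)
    (hb : b = a + k - 1) (hl : l = ⌊((a : ℚ) - 2) / ((k : ℚ) - 1)⌋₊)
    (p q m : ℕ) (hq : 0 < q) (hqp : q < p) (hpm : p < m) :
    propModular p m q = (apSemigroup a 1 k : Set ℕ) ↔
      (((m : ℚ) / a ≤ p ∧ (p : ℚ) < m * (l + 1) / ((l + 1) * a - 1) ∧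
          (p : ℚ) - m / b ≤ q ∧ (q : ℚ) < p - m * l / (l * b + 1)) ∨
        ((m : ℚ) - m / b ≤ p ∧ (p : ℚ) < m - m * l / (l * b + 1) ∧
          (p : ℚ) - m + m / a ≤ q ∧
          (q : ℚ) < p - m + m * (l + 1) / ((l + 1) * a - 1)) ∨
        (k = a ∧
          ((2 * (m : ℚ) / b ≤ p ∧ (p : ℚ) < m / (a - 1) ∧
              (p : ℚ) - m / (b - 1) ≤ q ∧ (q : ℚ) < p) ∨
            ((m : ℚ) - m / (b - 1) ≤ p ∧ (p : ℚ) < m ∧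
              (p : ℚ) - m + 2 * m / b ≤ q ∧ (q : ℚ) < p - m + m / (a - 1))))) := by
  obtain ⟨hl1, hl2⟩ := floor_div_spec hk hka hl
  have hb1 : 1 < b := by omega
  rw [propModular_eq_intervalSet (by omega),
    intervalSet_eq_apSemigroup_iff hk hka hl1 hl2 (by omega) (by omega) (by omega), ← hb,
    unitFractionCase_iff_rat (by omega) (by omega) (by omega),
    unitFractionCase_iff_rat (by omega) (by omega) (by omega),
    halfLineCase_iff_rat (by omega) (by omega), halfLineCase_iff_rat (by omega) (by omega)]
  push_cast
  have hq' : (0 : ℚ) < q := by exact_mod_cast hq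
  have hqp' : (q : ℚ) < p := by exact_mod_cast hqp
  have hpm' : (p : ℚ) < m := by exact_mod_cast hpm
  refine or_congr ?_ (or_congr ?_ (and_congr_right fun _ => or_congr ?_ ?_))
  · constructor <;> rintro ⟨h1, h2, h3, h4⟩ <;> refine ⟨?_, ?_, ?_, ?_⟩ <;> linarith
  · constructor <;> rintro ⟨h1, h2, h3, h4⟩ <;> refine ⟨?_, ?_, ?_, ?_⟩ <;> linarith
  · constructor
    · rintro ⟨h1, h2, h3⟩
      exact ⟨h1, h2, by linarith, hqp'⟩
    · rintro ⟨h1, h2, h3, -⟩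
      exact ⟨h1, h2, by linarith⟩
  · constructor
    · rintro ⟨h1, h2, h3⟩
      exact ⟨by linarith, hpm', by linarith, by linarith⟩
    · rintro ⟨h1, -, h3, h4⟩
      exact ⟨by linarith, by linarith, by linarith⟩
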